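/- Let $\mathcal C$ be a Markov category: a symmetric monoidal category with terminal unit $I$ in which every object $X$ carries a commutative comonoid structure $(\mathrm{copy}_X,\mathrm{del}_X)$ compatible with the monoidal structure. Assume that $\mathcal C$ has conditionals: for every $f:A\to X\otimes Y$ there is $f_{|X}:X\otimes A\to Y$ such that $$f=(\mathrm{id}_X\otimes f_{|X})\circ(\mathrm{copy}_X\otimes \mathrm{id}_A)\circ(f_X\otimes\mathrm{id}_A)\circ\mathrm{copy}_A,$$ where $f_X=(\mathrm{id}_X\otimes\mathrm{del}_Y)\circ f$ is the marginal of $f$ on $X$. For a state $p:I\to X$, morphisms $f,g:X\to Y$ are $p$-a.s. equal, $f\simeq_p g$, if $(\mathrm{id}_X\otimes f)\circ\mathrm{copy}_X\circ p=(\mathrm{id}_X\otimes g)\circ\mathrm{copy}_X\circ p$, and $f$ is $p$-a.s. deterministic if $\mathrm{copy}_Y\circ f\simeq_p(f\otimes f)\circ\mathrm{copy}_X$. A Bayesian inverse of $f$ relative to $p$ is a morphism $f^\dagger:Y\to X$ with $(\mathrm{id}_X\otimes f)\circ\mathrm{copy}_X\circ p=(f^\dagger\otimes\mathrm{id}_Y)\circ\mathrm{copy}_Y\circ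 f\circ p$. Let $\mathrm{PS}(\mathcal C)$ be the category whose objects are pairs $(X,p)$ of an object of $\mathcal C$ and a state on it, and whose morphisms $(X,p)\to(Y,q)$ are the morphisms $f:X\to Y$ with $f\circ p=q$, modulo $p$-a.s. equality. Since $\mathcal C$ has conditionals, Bayesian inverses exist and are a.s. unique, so each $f:(X,p)\to(Y,q)$ of $\mathrm{PS}(\mathcal C)$ determines a morphism $f^\dagger:(Y,q)\to(X,p)$ of $\mathrm{PS}(\mathcal C)$. A dynamical system in $\mathrm{PS}(\mathcal C)$ on $(X,p)$ with monoid $M$ is a functor $D:M\to\mathrm{PS}(\mathcal C)$ from $M$, seen as a one-object category, with value $(X,p)$; the image of $m\in M$ is again written $m:(X,p)\to(X,p)$. An invariant object for $D$ is a colimit $r:(X,p)\to(X_{\mathrm{inv}},p_{\mathrm{inv}})$ of $D$ in $\mathrm{PS}(\mathcal C)$ such that for every morphism $f:(X,p)\to(Y,q)$ with $f\circ m\simeq_p f$ for all $m\in M$, with induced morphism $\tilde f:(X_{\mathrm{inv}},p_{\mathrm{inv}})\to(Y,q)$, $f$ is $p$-a.s. deterministic if and only if $\tilde f$ is $p_{\mathrm{inv}}$-a.s.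 deterministic. **Theorem.** Suppose that every dynamical system in $\mathrm{PS}(\mathcal C)$ has an invariant object. Let $D$ be a dynamical system in $\mathrm{PS}(\mathcal C)$ on $(X,p)$ with monoid $M$, and let $r:(X,p)\to(X_{\mathrm{inv}},p_{\mathrm{inv}})$ be an invariant object for $D$. Then $(X_{\mathrm{inv}},p_{\mathrm{inv}})$ is also the limit of $D$ in $\mathrm{PS}(\mathcal C)$, with limiting cone the Bayesian inverse $r^\dagger:(X_{\mathrm{inv}},p_{\mathrm{inv}})\to(X,p)$ of $r$. In particular $m\circ r^\dagger\simeq_{p_{\mathrm{inv}}}r^\dagger$ for all $m\in M$, and for every $g:(A,q)\to(X,p)$ in $\mathrm{PS}(\mathcal C)$ with $m\circ g\simeq_q g$ for all $m\in M$ there is a $q$-a.s. unique $\tilde g:(A,q)\to(X_{\mathrm{inv}},p_{\mathrm{inv}})$ in $\mathrm{PS}(\mathcal C)$ with $g\simeq_q r^\dagger\circ\tilde g$. -/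

import Mathlib

open CategoryTheory MonoidalCategory ComonObj Limits

universe w v u

namespace MarkovPS

section Markov

variable {C : Type u} [Category.{v} C] [MonoidalCategory.{v} C] [MarkovCategory C]

/-- `f` and `g` are `p`-almost surely equal. (In a Markov category a state on `X` is a morphism
`p : 𝟙_ C ⟶ X`; the same equation makes sense for any `p : A ⟶ X`.) -/
def ASEq {A X Y : C} (p : A ⟶ X) (f g : X ⟶ Y) : Prop :=
  p ≫ Δ[X] ≫ X ◁ f = p ≫ Δ[X] ≫ X ◁ g

/-- `f` is `p`-almost surely deterministic: copying its output is, `p`-almost surely, the same as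
running it independently on two copies of the input. -/
def ASDeterministic {A X Y : C} (p : A ⟶ X) (f : X ⟶ Y) : Prop :=
  ASEq p (f ≫ Δ[Y]) (Δ[X] ≫ (f ⊗ₘ f))

/-- `g : Y ⟶ X` is a Bayesian inverse of `f : X ⟶ Y` relative to the state `p` on `X`: the joint
state on `X ⊗ Y` obtained from `p` and `f` equals the one obtained from `p ≫ f` and `g`. -/
def IsBayesianInverse {X Y : C} (p : 𝟙_ C ⟶ X) (f : X ⟶ Y) (g : Y ⟶ X) : Prop :=
  p ≫ Δ[X] ≫ X ◁ f = (p ≫ f) ≫ Δ[Y] ≫ g ▷ Y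

variable (C) in
/-- A Markov category is causal if whenever `h₁` and `h₂` agree almost surely with respect to
`f ≫ g`, they also agree jointly with the output of `f`. -/
class Causal : Prop where
  causal {A X Y Z : C} (f : A ⟶ X) (g : X ⟶ Y) (h₁ h₂ : Y ⟶ Z) :
    ASEq (f ≫ g) h₁ h₂ → ASEq f (g ≫ Δ[Y] ≫ Y ◁ h₁) (g ≫ Δ[Y] ≫ Y ◁ h₂)

variable (C) in
/-- A Markov category has conditionals if every `f : A ⟶ X ⊗ Y` can be generated by first
generating its marginal on `X`, and then the output in `Y` from the output in `X` and the input
in `A`. -/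
class HasConditionals : Prop where
  exists_conditional {A X Y : C} (f : A ⟶ X ⊗ Y) :
    ∃ k : X ⊗ A ⟶ Y,
      f = Δ[A] ≫ (((f ≫ X ◁ ε[Y] ≫ (ρ_ X).hom) ≫ Δ[X]) ▷ A) ≫ (α_ X X A).hom ≫ X ◁ k

theorem copy_braid (X : C) : Δ[X] ≫ (β_ X X).hom = Δ[X] := IsCommComonObj.comul_comm X

theorem copy_fst {Y Z : C} (g : Y ⟶ Z) :
    (Δ[Y] ≫ Y ◁ g) ≫ ε[Y] ▷ Z ≫ (λ_ Z).hom = g := by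
  rw [Category.assoc, whisker_exchange_assoc, counit_comul_assoc]
  simp

theorem copy_snd {Y Z : C} (g : Y ⟶ Z) :
    (Δ[Y] ≫ g ▷ Y) ≫ Z ◁ ε[Y] ≫ (ρ_ Z).hom = g := by
  rw [Category.assoc, ← whisker_exchange_assoc, comul_counit_assoc]
  simp

/-- Swapping the two outputs of a copied input. -/
theorem copy_swap {X Y : C} (f : X ⟶ Y) :
    Δ[X] ≫ X ◁ f = (Δ[X] ≫ f ▷ X) ≫ (β_ Y X).hom := by
  rw [Category.assoc, BraidedCategory.braiding_naturality_left, ← Category.assoc, copy_braid]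

theorem copy_swap' {X Y : C} (f : X ⟶ Y) :
    Δ[X] ≫ f ▷ X = (Δ[X] ≫ X ◁ f) ≫ (β_ X Y).hom := by
  rw [Category.assoc, BraidedCategory.braiding_naturality_right, ← Category.assoc, copy_braid]

theorem asEq_iff_right {A X Y : C} {p : A ⟶ X} {f g : X ⟶ Y} :
    ASEq p f g ↔ p ≫ Δ[X] ≫ f ▷ X = p ≫ Δ[X] ≫ g ▷ X := by
  unfold ASEq
  constructor
  · intro h
    rw [copy_swap', copy_swap', ← Category.assoc, h, Category.assoc]
  · intro h
    rw [copy_swap, copy_swap, ← Category.assoc, h, Category.assoc]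

theorem ASEq.comp_right {A X Y Z : C} {p : A ⟶ X} {f g : X ⟶ Y} (h : ASEq p f g) (k : Y ⟶ Z) :
    ASEq p (f ≫ k) (g ≫ k) := by
  unfold ASEq at *
  have := congrArg (· ≫ X ◁ k) h
  simpa using this

theorem ASEq.comp_left [Causal C] {A X Y Z : C} {p : A ⟶ X} (f : X ⟶ Y) {g h : Y ⟶ Z}
    (e : ASEq (p ≫ f) g h) : ASEq p (f ≫ g) (f ≫ h) := by
  have := (Causal.causal p f g h e).comp_right (ε[Y] ▷ Z ≫ (λ_ Z).hom)
  rwa [Category.assoc, copy_fst, Category.assoc, copy_fst] at this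

theorem copy_three (Y : C) :
    Δ[Y] ≫ Δ[Y] ▷ Y ≫ (α_ Y Y Y).hom ≫ Y ◁ (β_ Y Y).hom ≫ (α_ Y Y Y).inv =
      Δ[Y] ≫ Δ[Y] ▷ Y := by
  have := comul_assoc Y
  have h2 : Δ[Y] ≫ Δ[Y] ▷ Y = Δ[Y] ≫ Y ◁ Δ[Y] ≫ (α_ Y Y Y).inv := by
    rw [comul_assoc_assoc]; simp
  rw [← comul_assoc_assoc, h2, ← MonoidalCategory.whiskerLeft_comp_assoc, copy_braid]

theorem copy_copy {Y Z : C} (h : Y ⟶ Z) :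
    Δ[Y] ≫ (Δ[Y] ≫ Y ◁ h) ▷ Y =
      (Δ[Y] ≫ Y ◁ h) ≫ Δ[Y] ▷ Z ≫ (α_ Y Y Z).hom ≫ Y ◁ (β_ Y Z).hom ≫ (α_ Y Z Y).inv := by
  rw [comp_whiskerRight, ← Category.assoc, ← copy_three]
  simp only [Category.assoc]
  rw [whisker_exchange_assoc]
  congr 2
  simp [← MonoidalCategory.whiskerLeft_comp]

theorem causal_of_hasConditionals [HasConditionals C] {A X Y Z : C} (f : A ⟶ X) (g : X ⟶ Y)
    (h₁ h₂ : Y ⟶ Z) (e : ASEq (f ≫ g) h₁ h₂) :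
    ASEq f (g ≫ Δ[Y] ≫ Y ◁ h₁) (g ≫ Δ[Y] ≫ Y ◁ h₂) := by
  obtain ⟨k, hk⟩ := HasConditionals.exists_conditional (f ≫ Δ[X] ≫ g ▷ X)
  have hm : (f ≫ Δ[X] ≫ g ▷ X) ≫ Y ◁ ε[X] ≫ (ρ_ Y).hom = f ≫ g := by
    rw [Category.assoc, copy_snd]
  rw [hm] at hk
  have key : ∀ h : Y ⟶ Z, f ≫ Δ[X] ≫ (g ≫ Δ[Y] ≫ Y ◁ h) ▷ X =
      Δ[A] ≫ (((f ≫ g) ≫ Δ[Y] ≫ Y ◁ h) ≫ Δ[Y] ▷ Z ≫ (α_ Y Y Z).hom ≫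
        Y ◁ (β_ Y Z).hom ≫ (α_ Y Z Y).inv) ▷ A ≫ (α_ (Y ⊗ Z) Y A).hom ≫ (Y ⊗ Z) ◁ k := by
    intro h
    have h1 : f ≫ Δ[X] ≫ (g ≫ Δ[Y] ≫ Y ◁ h) ▷ X =
        (f ≫ Δ[X] ≫ g ▷ X) ≫ (Δ[Y] ≫ Y ◁ h) ▷ X := by simp
    rw [h1, hk, Category.assoc (f ≫ g), ← copy_copy h]
    simp only [Category.assoc]
    rw [whisker_exchange]
    simp
  rw [asEq_iff_right, key, key, e]

instance [HasConditionals C] : Causal C where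
  causal := causal_of_hasConditionals

theorem asEq_refl {A X Y : C} (p : A ⟶ X) (f : X ⟶ Y) : ASEq p f f := rfl

/-- Almost sure equality is preserved by attaching further copies of the input. -/
theorem ASEq.copy_left {A X Y W : C} {p : A ⟶ X} {f g : X ⟶ Y} (h : ASEq p f g) (k : X ⟶ W) :
    ASEq p (Δ[X] ≫ (k ⊗ₘ f)) (Δ[X] ≫ (k ⊗ₘ g)) := by
  have key : ∀ f : X ⟶ Y, Δ[X] ≫ X ◁ (Δ[X] ≫ (k ⊗ₘ f)) =
      (Δ[X] ≫ X ◁ f) ≫ (Δ[X] ≫ X ◁ k) ▷ Y ≫ (α_ X W Y).hom := by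
    intro f
    rw [MonoidalCategory.whiskerLeft_comp, comul_assoc_assoc, Category.assoc,
      whisker_exchange_assoc]
    simp [MonoidalCategory.tensorHom_def]
  unfold ASEq
  rw [key, key, ← Category.assoc, h, Category.assoc]

theorem ASEq.copy_right {A X Y W : C} {p : A ⟶ X} {f g : X ⟶ Y} (h : ASEq p f g) (k : X ⟶ W) :
    ASEq p (Δ[X] ≫ (f ⊗ₘ k)) (Δ[X] ≫ (g ⊗ₘ k)) := by
  have key : ∀ f : X ⟶ Y, Δ[X] ≫ (f ⊗ₘ k) = (Δ[X] ≫ (k ⊗ₘ f)) ≫ (β_ W Y).hom := by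
    intro f
    rw [Category.assoc, BraidedCategory.braiding_naturality, ← Category.assoc, copy_braid]
  rw [key, key]
  exact (h.copy_left k).comp_right _

theorem ASDeterministic.congr {A X Y : C} {p : A ⟶ X} {f g : X ⟶ Y} (h : ASEq p f g)
    (hf : ASDeterministic p f) : ASDeterministic p g :=
  ((h.comp_right Δ[Y]).symm.trans hf).trans ((h.copy_left f).trans (h.copy_right g))

theorem exists_isBayesianInverse [HasConditionals C] {X Y : C} (p : 𝟙_ C ⟶ X) (f : X ⟶ Y) :
    ∃ g : Y ⟶ X, IsBayesianInverse p f g := by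
  obtain ⟨k, hk⟩ := HasConditionals.exists_conditional (p ≫ Δ[X] ≫ f ▷ X)
  have hm : (p ≫ Δ[X] ≫ f ▷ X) ≫ Y ◁ ε[X] ≫ (ρ_ Y).hom = p ≫ f := by
    rw [Category.assoc, copy_snd]
  rw [hm, CopyDiscardCategory.copy_unit] at hk
  refine ⟨(ρ_ Y).inv ≫ k, ?_⟩
  unfold IsBayesianInverse
  rw [copy_swap f, copy_swap' ((ρ_ Y).inv ≫ k), ← Category.assoc, hk, ← Category.assoc (p ≫ f)]
  congr 1
  rw [unitors_inv_equal, ← rightUnitor_inv_naturality_assoc]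
  simp

theorem IsBayesianInverse.comp_eq {X Y : C} {p : 𝟙_ C ⟶ X} {f : X ⟶ Y} {g : Y ⟶ X}
    (h : IsBayesianInverse p f g) : (p ≫ f) ≫ g = p := by
  have := congrArg (· ≫ X ◁ ε[Y] ≫ (ρ_ X).hom) h
  simp only [Category.assoc] at this
  have h2 := copy_snd g
  simp only [Category.assoc] at h2
  rw [h2, ← MonoidalCategory.whiskerLeft_comp_assoc, MarkovCategory.discard_natural,
    comul_counit_assoc, Iso.inv_hom_id, Category.comp_id] at this
  rw [Category.assoc, ← this]

/-- A morphism is a Bayesian inverse of `f` if and only if it is almost surely equal to a given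
Bayesian inverse. -/
theorem IsBayesianInverse.iff_asEq {X Y : C} {p : 𝟙_ C ⟶ X} {f : X ⟶ Y} {g g' : Y ⟶ X}
    (h : IsBayesianInverse p f g) : IsBayesianInverse p f g' ↔ ASEq (p ≫ f) g g' := by
  rw [asEq_iff_right, IsBayesianInverse, show _ = _ from h]

theorem IsBayesianInverse.congr {X Y : C} {p : 𝟙_ C ⟶ X} {f f' : X ⟶ Y} {g : Y ⟶ X}
    (h : IsBayesianInverse p f g) (e : ASEq p f f') (e' : p ≫ f = p ≫ f') :
    IsBayesianInverse p f' g := by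
  unfold IsBayesianInverse
  rw [← e', ← show _ = _ from h, show _ = _ from e]

end Markov

/-- Objects of `PS(C)`: objects of `C` equipped with a state. -/
structure PS (C : Type u) [Category.{v} C] [MonoidalCategory.{v} C] where
  obj : C
  state : 𝟙_ C ⟶ obj

namespace PS

variable {C : Type u} [Category.{v} C] [MonoidalCategory.{v} C] [MarkovCategory C]

/-- State-preserving morphisms of `C`. -/
def PreHom (X Y : PS C) : Type v :=
  { f : X.obj ⟶ Y.obj // X.state ≫ f = Y.state }

/-- State-preserving morphisms up to almost sure equality. -/
instance homSetoid (X Y : PS C) : Setoid (PreHom X Y) where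
  r f g := ASEq X.state f.1 g.1
  iseqv := ⟨fun _ => rfl, fun h => Eq.symm h, fun h k => Eq.trans h k⟩

/-- The category `PS(C)` of a causal Markov category `C`. -/
instance [Causal C] : Category.{v} (PS C) where
  Hom X Y := Quotient (homSetoid X Y)
  id X := Quotient.mk _ ⟨𝟙 X.obj, Category.comp_id _⟩
  comp {X Y Z} f g := Quotient.map₂
    (fun (f : PreHom X Y) (g : PreHom Y Z) =>
      (⟨f.1 ≫ g.1, by rw [← Category.assoc, f.2, g.2]⟩ : PreHom X Z))
    (fun f f' hf g g' hg => by
      change ASEq X.state (f.1 ≫ g.1) (f'.1 ≫ g'.1)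
      have hg' : ASEq (X.state ≫ f'.1) g.1 g'.1 := by rw [f'.2]; exact hg
      exact (ASEq.comp_right hf g.1).trans (ASEq.comp_left f'.1 hg')) f g
  id_comp := by
    rintro X Y ⟨f⟩
    exact congrArg (Quotient.mk _) (Subtype.ext (Category.id_comp f.1))
  comp_id := by
    rintro X Y ⟨f⟩
    exact congrArg (Quotient.mk _) (Subtype.ext (Category.comp_id f.1))
  assoc := by
    rintro X Y Z W ⟨f⟩ ⟨g⟩ ⟨h⟩
    exact congrArg (Quotient.mk _) (Subtype.ext (Category.assoc f.1 g.1 h.1))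

/-- The morphism of `PS(C)` represented by a state-preserving morphism of `C`. -/
def homMk [Causal C] {X Y : PS C} (f : X.obj ⟶ Y.obj) (hf : X.state ≫ f = Y.state) : X ⟶ Y :=
  Quotient.mk (homSetoid X Y) ⟨f, hf⟩

theorem homMk_eq_iff [Causal C] {X Y : PS C} {f g : X.obj ⟶ Y.obj}
    {hf : X.state ≫ f = Y.state} {hg : X.state ≫ g = Y.state} :
    homMk f hf = homMk g hg ↔ ASEq X.state f g :=
  Quotient.eq (r := homSetoid X Y)

/-- A morphism of `PS(C)` is almost surely deterministic if its representatives are. -/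
def IsASDeterministic [Causal C] {X Y : PS C} (f : X ⟶ Y) : Prop :=
  Quotient.lift (s := homSetoid X Y) (fun g => ASDeterministic X.state g.1)
    (fun _ _ h => propext ⟨ASDeterministic.congr h, ASDeterministic.congr (Eq.symm h)⟩) f

/-- The dagger of `PS(C)`, given by Bayesian inversion. -/
noncomputable def dagger [HasConditionals C] {X Y : PS C} (f : X ⟶ Y) : Y ⟶ X :=
  Quotient.lift (s := homSetoid X Y)
    (fun g => homMk (X := Y) (Y := X) (exists_isBayesianInverse X.state g.1).choose (by
      have := (exists_isBayesianInverse X.state g.1).choose_spec.comp_eq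
      rwa [g.2] at this))
    (fun g g' h => by
      rw [homMk_eq_iff]
      have h1 := (exists_isBayesianInverse X.state g.1).choose_spec
      have h2 := (exists_isBayesianInverse X.state g'.1).choose_spec
      have := (h1.congr h (g.2.trans g'.2.symm)).iff_asEq.1 h2
      rwa [g'.2] at this) f

/-- The morphisms representing `dagger f` are exactly the Bayesian inverses of `f`. -/
theorem dagger_homMk_eq_iff [HasConditionals C] {X Y : PS C} {f : X.obj ⟶ Y.obj}
    {hf : X.state ≫ f = Y.state} {g : Y.obj ⟶ X.obj} {hg : Y.state ≫ g = X.state} :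
    dagger (homMk f hf) = homMk g hg ↔ IsBayesianInverse X.state f g := by
  have h1 := (exists_isBayesianInverse X.state f).choose_spec
  rw [h1.iff_asEq, hf]
  exact homMk_eq_iff

end PS

section Dynamics

variable {M : Type w} [Monoid M] {E : Type u} [Category.{v} E]

/-- A dynamical system in `E` with monoid `M` is a functor `D : SingleObj M ⥤ E`; this is the
object on which it acts. -/
abbrev space (D : SingleObj M ⥤ E) : E := D.obj (SingleObj.star M)

/-- The endomorphism by which `m : M` acts. -/
abbrev act (D : SingleObj M ⥤ E) (m : M) : space D ⟶ space D :=
  D.map (X := SingleObj.star M) (Y := SingleObj.star M) m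

/-- Left-invariant morphisms `h : A ⟶ X`: `m ∘ h = h` for all `m`. -/
def IsLeftInvariant (D : SingleObj M ⥤ E) {A : E} (h : A ⟶ space D) : Prop :=
  ∀ m : M, h ≫ act D m = h

/-- Left-invariant morphisms are the cones over `D`. -/
def IsLeftInvariant.cone {D : SingleObj M ⥤ E} {A : E} {h : A ⟶ space D}
    (hh : IsLeftInvariant D h) : Cone D where
  pt := A
  π :=
    { app := fun _ => h
      naturality := fun _ _ m => (Category.id_comp h).trans (hh m).symm }

/-- The leg of a cocone under `D`, a right-invariant morphism. -/
abbrev leg {D : SingleObj M ⥤ E} (c : Cocone D) : space D ⟶ c.pt :=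
  c.ι.app (SingleObj.star M)

end Dynamics

section Invariant

variable {C : Type u} [Category.{v} C] [MonoidalCategory.{v} C] [MarkovCategory C] [Causal C]

/-- An invariant object of a dynamical system in `PS(C)`: a colimit such that a right-invariant
morphism is almost surely deterministic if and only if the induced morphism out of the colimit
is. -/
def IsInvariantObject {M : Type w} [Monoid M] {D : SingleObj M ⥤ PS C} (c : Cocone D) : Prop :=
  ∃ hc : IsColimit c, ∀ s : Cocone D,
    PS.IsASDeterministic (leg s) ↔ PS.IsASDeterministic (hc.desc s)

variable (C) in
/-- `PS(C)` has all invariant objects (of dynamical systems indexed by monoids in `Type w`). -/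
def HasInvariantObjects : Prop :=
  ∀ (M : Type w) [Monoid M] (D : SingleObj M ⥤ PS C), ∃ c : Cocone D, IsInvariantObject c

end Invariant

end MarkovPS

namespace MarkovPS

/-! ### Joint states, conditionals and Bayesian inverses -/

section Markov

variable {C : Type u} [Category.{v} C] [MonoidalCategory.{v} C] [MarkovCategory C]

/-! The crux is that an almost surely deterministic `f` with `f ∘ m = f` also satisfies `f ∘ m† = f`
(`IsBayesianInverse.asEq_comp_of_asEq_comp`). Sample `x` from `p` and `y` from `m x`: invariance and
determinism make `f x` and `f y` almost surely equal, so they may be exchanged even jointly with `y`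
(`comp_braiding_of_marginal_eq`). Forgetting one of them, `(f x, y)` and `(f y, y)` have the same
law; seen from `y`, this is the claim.

The leg `r` of an invariant object is almost surely deterministic, as it induces the identity. Hence
`r ∘ m† = r`, and daggering gives `m ∘ r† = r†`. Conversely, if `m ∘ g = g` then `g†` is
`m†`-invariant, though perhaps not deterministic. It factors through the invariant object of the
daggered system, whose leg is deterministic, hence `m`-invariant, and so factors through `r`.
Daggering back factors `g` through `r†`. -/

/-- Exchanging the middle two of four copies has no effect. -/
theorem copy_four (Y : C) :
    Δ[Y] ≫ (Δ[Y] ⊗ₘ Δ[Y]) ≫ tensorμ Y Y Y Y = Δ[Y] ≫ (Δ[Y] ⊗ₘ Δ[Y]) := by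
  -- Rebracketed so that the middle two copies come from a single `Δ[Y]`, where cocommutativity
  -- absorbs the swap.
  have h1 : Δ[Y] ≫ (Δ[Y] ⊗ₘ Δ[Y]) =
      (Δ[Y] ≫ Y ◁ (Δ[Y] ≫ Δ[Y] ▷ Y)) ≫ Y ◁ (α_ Y Y Y).hom ≫ (α_ Y Y (Y ⊗ Y)).inv := by
    rw [Category.assoc, ← MonoidalCategory.whiskerLeft_comp_assoc, Category.assoc,
      ← comul_assoc, MonoidalCategory.tensorHom_def, MonoidalCategory.whiskerLeft_comp_assoc,
      comul_assoc_assoc]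
    simp
  rw [reassoc_of% h1, h1, tensorμ]
  simp only [Category.assoc, Iso.inv_hom_id_assoc, ← MonoidalCategory.whiskerLeft_comp_assoc,
    Iso.hom_inv_id_assoc]
  rw [← comp_whiskerRight_assoc, copy_braid]

/-- A joint state disintegrates along its first marginal. -/
theorem exists_state_conditional [HasConditionals C] {X Y : C} (w : 𝟙_ C ⟶ X ⊗ Y) :
    ∃ k : X ⟶ Y, w = (w ≫ X ◁ ε[Y] ≫ (ρ_ X).hom) ≫ Δ[X] ≫ X ◁ k := by
  obtain ⟨k, hk⟩ := HasConditionals.exists_conditional w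
  -- The input of `w` is the unit, so the conditional has no genuine parameter.
  refine ⟨(ρ_ X).inv ≫ k, ?_⟩
  rw [CopyDiscardCategory.copy_unit, unitors_inv_equal, ← rightUnitor_inv_naturality_assoc] at hk
  refine hk.trans ?_
  simp

/-- A joint state in which the first two components are almost surely equal is invariant under
exchanging them. -/
theorem comp_braiding_of_marginal_eq [HasConditionals C] {X Y : C} (w : 𝟙_ C ⟶ (Y ⊗ Y) ⊗ X)
    (q : 𝟙_ C ⟶ Y) (h : w ≫ (Y ⊗ Y) ◁ ε[X] ≫ (ρ_ (Y ⊗ Y)).hom = q ≫ Δ[Y]) :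
    w ≫ (β_ Y Y).hom ▷ X = w := by
  obtain ⟨k, hk⟩ := exists_state_conditional w
  rw [h, CopyDiscardCategory.copy_tensor] at hk
  simp only [Category.assoc] at hk
  -- Without `tensorμ`, the retained pair is itself an output of `Δ[Y]`, and the braiding fixes it.
  rw [reassoc_of% copy_four Y] at hk
  rw [hk]
  simp only [Category.assoc]
  rw [whisker_exchange, MonoidalCategory.tensorHom_def'_assoc, ← comp_whiskerRight_assoc,
    copy_braid, MonoidalCategory.tensorHom_def'_assoc]

theorem ASEq.comp_eq {A X Y : C} {p : A ⟶ X} {f g : X ⟶ Y} (h : ASEq p f g) :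
    p ≫ f = p ≫ g := by
  have := congrArg (· ≫ ε[X] ▷ Y ≫ (λ_ Y).hom) h
  have hc := fun k : X ⟶ Y => copy_fst k
  simp only [Category.assoc] at this hc
  rwa [hc, hc] at this

/-- If an almost surely deterministic morphism is invariant under a state-preserving morphism, then
it is invariant under the Bayesian inverse as well. -/
theorem IsBayesianInverse.asEq_comp_of_asEq_comp [HasConditionals C] {X Y : C} {p : 𝟙_ C ⟶ X}
    {m m' : X ⟶ X} (hm : IsBayesianInverse p m m') (hp : p ≫ m = p) {f : X ⟶ Y}
    (hf : ASDeterministic p f) (h : ASEq p (m ≫ f) f) : ASEq p (m' ≫ f) f := by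
  -- The joint state of `(f x, f y, y)`, with `y` drawn from `m x`; forgetting `y` leaves two copies
  -- of one value.
  have key := comp_braiding_of_marginal_eq
    (p ≫ Δ[X] ≫ (f ⊗ₘ (m ≫ Δ[X] ≫ f ▷ X)) ≫ (α_ Y Y X).inv) (p ≫ f) (by
      have e : (f ⊗ₘ (m ≫ Δ[X] ≫ f ▷ X)) ≫ (α_ Y Y X).inv ≫ (Y ⊗ Y) ◁ ε[X] ≫
          (ρ_ (Y ⊗ Y)).hom = X ◁ (m ≫ f) ≫ f ▷ Y := by
        have h0 := congrArg (m ≫ ·) (copy_snd f)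
        simp only [Category.assoc] at h0
        rw [whisker_exchange, ← MonoidalCategory.tensorHom_def, ← h0]
        simp [MonoidalCategory.tensorHom_def]
      have h1 : p ≫ Δ[X] ≫ X ◁ (m ≫ f) = p ≫ Δ[X] ≫ X ◁ f := h
      have h2 := hf.comp_eq
      simp only [Category.assoc]
      rw [e, reassoc_of% h1, h2, whisker_exchange, ← MonoidalCategory.tensorHom_def])
  -- Discarding the first component leaves `(f y, y)` without the swap (`e1`) and `(f x, y)` with it
  -- (`e2`).
  have h3 := congrArg (· ≫ (ε[Y] ▷ Y ≫ (λ_ Y).hom) ▷ X) key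
  have e1 : (f ⊗ₘ (m ≫ Δ[X] ≫ f ▷ X)) ≫ (α_ Y Y X).inv ≫ (ε[Y] ▷ Y ≫ (λ_ Y).hom) ▷ X =
      ε[X] ▷ X ≫ (λ_ X).hom ≫ m ≫ Δ[X] ≫ f ▷ X := by
    rw [MonoidalCategory.tensorHom_def'_assoc, comp_whiskerRight,
      ← associator_inv_naturality_left_assoc, ← comp_whiskerRight_assoc,
      MarkovCategory.discard_natural, whisker_exchange_assoc]
    simp
  have e2 : (f ⊗ₘ (m ≫ Δ[X] ≫ f ▷ X)) ≫ (α_ Y Y X).inv ≫ (β_ Y Y).hom ▷ X ≫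
      (ε[Y] ▷ Y ≫ (λ_ Y).hom) ▷ X = X ◁ m ≫ f ▷ X := by
    have h4 : (β_ Y Y).hom ≫ ε[Y] ▷ Y ≫ (λ_ Y).hom = Y ◁ ε[Y] ≫ (ρ_ Y).hom := by
      rw [← BraidedCategory.braiding_naturality_right_assoc, braiding_leftUnitor]
    have h5 : (m ≫ Δ[X] ≫ f ▷ X) ≫ ε[Y] ▷ X ≫ (λ_ X).hom = m := by
      simp only [Category.assoc]
      rw [← comp_whiskerRight_assoc, MarkovCategory.discard_natural, counit_comul_assoc]
      simp
    rw [← comp_whiskerRight, h4, whisker_exchange, ← MonoidalCategory.tensorHom_def]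
    conv_rhs => rw [← h5]
    simp [MonoidalCategory.tensorHom_def]
  simp only [Category.assoc] at h3
  rw [e1, e2, counit_comul_assoc, Iso.inv_hom_id_assoc, reassoc_of% hp] at h3
  rw [asEq_iff_right, ← h3]
  -- Inversion generates `x` from `y` by `m'`, so `(f x, y)` becomes `(f (m' y), y)`.
  have h4 : p ≫ Δ[X] ≫ X ◁ m = (p ≫ m) ≫ Δ[X] ≫ m' ▷ X := hm
  rw [hp] at h4
  rw [reassoc_of% h4]
  simp

theorem IsBayesianInverse.comp {X Y Z : C} {p : 𝟙_ C ⟶ X} {f : X ⟶ Y} {g : Y ⟶ Z} {f' : Y ⟶ X}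
    {g' : Z ⟶ Y} (hf : IsBayesianInverse p f f') (hg : IsBayesianInverse (p ≫ f) g g') :
    IsBayesianInverse p (f ≫ g) (g' ≫ f') := by
  unfold IsBayesianInverse at *
  rw [MonoidalCategory.whiskerLeft_comp, reassoc_of% hf, ← whisker_exchange,
    ← Category.assoc p f]
  simp only [Category.assoc] at hg ⊢
  rw [reassoc_of% hg]
  simp

/-- Both sides describe one joint state, so swapping its outputs exchanges the roles of `f` and `g`.
-/
theorem IsBayesianInverse.symm {X Y : C} {p : 𝟙_ C ⟶ X} {f : X ⟶ Y} {g : Y ⟶ X}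
    (h : IsBayesianInverse p f g) : IsBayesianInverse (p ≫ f) g f := by
  have h' := h.comp_eq
  unfold IsBayesianInverse at *
  rw [h', copy_swap, copy_swap' f, ← Category.assoc p, h, Category.assoc (p ≫ f)]

theorem isBayesianInverse_id {X : C} (p : 𝟙_ C ⟶ X) : IsBayesianInverse p (𝟙 X) (𝟙 X) := by
  simp [IsBayesianInverse]

end Markov

/-! ### The dagger structure of `PS C` -/

namespace PS

variable {C : Type u} [Category.{v} C] [MonoidalCategory.{v} C] [MarkovCategory C]

theorem homMk_surjective [Causal C] {X Y : PS C} (f : X ⟶ Y) :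
    ∃ (g : X.obj ⟶ Y.obj) (hg : X.state ≫ g = Y.state), homMk g hg = f := by
  obtain ⟨g, rfl⟩ := Quotient.exists_rep f
  exact ⟨g.1, g.2, rfl⟩

theorem exists_dagger_homMk_eq [HasConditionals C] {X Y : PS C} (f : X ⟶ Y) :
    ∃ (g : X.obj ⟶ Y.obj) (hg : X.state ≫ g = Y.state) (g' : Y.obj ⟶ X.obj)
      (hg' : Y.state ≫ g' = X.state), homMk g hg = f ∧ dagger f = homMk g' hg' ∧
        IsBayesianInverse X.state g g' := by
  obtain ⟨g, hg, rfl⟩ := homMk_surjective f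
  obtain ⟨g', hg', h⟩ := homMk_surjective (dagger (homMk g hg))
  exact ⟨g, hg, g', hg', rfl, h.symm, dagger_homMk_eq_iff.1 h.symm⟩

theorem dagger_id [HasConditionals C] (X : PS C) : dagger (𝟙 X) = 𝟙 X :=
  dagger_homMk_eq_iff (hf := Category.comp_id _) (hg := Category.comp_id _) |>.2
    (isBayesianInverse_id X.state)

theorem dagger_comp [HasConditionals C] {X Y Z : PS C} (f : X ⟶ Y) (g : Y ⟶ Z) :
    dagger (f ≫ g) = dagger g ≫ dagger f := by
  obtain ⟨a, ha, a', ha', rfl, e, h⟩ := exists_dagger_homMk_eq f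
  obtain ⟨b, hb, b', hb', rfl, e', h'⟩ := exists_dagger_homMk_eq g
  rw [e, e']
  refine dagger_homMk_eq_iff (hf := by rw [reassoc_of% ha, hb])
    (hg := by rw [reassoc_of% hb', ha']) |>.2 (h.comp ?_)
  rwa [ha]

theorem dagger_dagger [HasConditionals C] {X Y : PS C} (f : X ⟶ Y) : dagger (dagger f) = f := by
  obtain ⟨a, ha, a', ha', rfl, e, h⟩ := exists_dagger_homMk_eq f
  rw [e, dagger_homMk_eq_iff, ← ha]
  exact h.symm

theorem isASDeterministic_id [Causal C] (X : PS C) : IsASDeterministic (𝟙 X) := by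
  change ASDeterministic X.state (𝟙 X.obj)
  simp [ASDeterministic, ASEq]

/-- An almost surely deterministic morphism which is invariant under an endomorphism is also
invariant under its dagger. -/
theorem IsASDeterministic.dagger_comp_eq [HasConditionals C] {X Y : PS C} {m : X ⟶ X} {f : X ⟶ Y}
    (hf : IsASDeterministic f) (h : m ≫ f = f) : dagger m ≫ f = f := by
  obtain ⟨a, ha, a', ha', rfl, e, hb⟩ := exists_dagger_homMk_eq m
  obtain ⟨b, hb', rfl⟩ := homMk_surjective f
  rw [e]
  exact homMk_eq_iff (hf := by rw [reassoc_of% ha', hb']) |>.2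
    (hb.asEq_comp_of_asEq_comp ha hf
      (homMk_eq_iff (hf := by rw [reassoc_of% ha, hb']) (hg := hb') |>.1 h))

end PS

/-! ### Invariant objects and the dagger system -/

section Dynamics

/-- Right-invariant morphisms are the cocones under a dynamical system. -/
def coconeOfRightInvariant {M : Type w} [Monoid M] {E : Type u} [Category.{v} E]
    {D : SingleObj M ⥤ E} {A : E} (h : space D ⟶ A) (hh : ∀ m : M, act D m ≫ h = h) :
    Cocone D where
  pt := A
  ι :=
    { app := fun _ => h
      naturality := fun _ _ m => (hh m).trans (Category.comp_id h).symm }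

theorem act_comp_leg {M : Type w} [Monoid M] {E : Type u} [Category.{v} E]
    {D : SingleObj M ⥤ E} (c : Cocone D) (m : M) : act D m ≫ leg c = leg c :=
  c.w (j := SingleObj.star M) (j' := SingleObj.star M) m

variable {C : Type u} [Category.{v} C] [MonoidalCategory.{v} C] [MarkovCategory C]

/-- The leg of an invariant object is almost surely deterministic. -/
theorem IsInvariantObject.isASDeterministic_leg [Causal C] {M : Type w} [Monoid M]
    {D : SingleObj M ⥤ PS C} {c : Cocone D} (hc : IsInvariantObject c) :
    PS.IsASDeterministic (leg c) := by
  obtain ⟨hcol, h⟩ := hc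
  rw [h c, hcol.desc_self]
  exact PS.isASDeterministic_id _

/-- The dynamical system of the opposite monoid in which every element acts by the dagger of its
original action. -/
noncomputable def daggerSystem [HasConditionals C] {M : Type w} [Monoid M]
    (D : SingleObj M ⥤ PS C) : SingleObj Mᵐᵒᵖ ⥤ PS C where
  obj _ := space D
  map m := PS.dagger (act D (MulOpposite.unop m))
  map_id _ := (congrArg PS.dagger (D.map_id (SingleObj.star M))).trans (PS.dagger_id _)
  -- `unop` and `dagger` each reverse composition, so the two reversals cancel.
  map_comp m n := (congrArg PS.dagger (D.map_comp (X := SingleObj.star M) (Y := SingleObj.star M)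
    (Z := SingleObj.star M) (MulOpposite.unop n) (MulOpposite.unop m))).trans
      (PS.dagger_comp _ _)

/-- There is an almost surely deterministic morphism which is weakly universal among the morphisms
invariant under the daggers of the action. -/
theorem exists_dagger_invariant [HasConditionals C] (hinv : HasInvariantObjects.{w} C)
    {M : Type w} [Monoid M] (D : SingleObj M ⥤ PS C) :
    ∃ (B : PS C) (r : space D ⟶ B), PS.IsASDeterministic r ∧
      (∀ m : M, PS.dagger (act D m) ≫ r = r) ∧
      ∀ (A : PS C) (f : space D ⟶ A), (∀ m : M, PS.dagger (act D m) ≫ f = f) →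
        ∃ k : B ⟶ A, r ≫ k = f := by
  obtain ⟨c, hc⟩ := hinv Mᵐᵒᵖ (daggerSystem D)
  refine ⟨c.pt, leg c, hc.isASDeterministic_leg, fun m => act_comp_leg c (MulOpposite.op m),
    fun A f hf => ?_⟩
  obtain ⟨hcol, -⟩ := hc
  exact ⟨hcol.desc (coconeOfRightInvariant (D := daggerSystem D) f fun m => hf m.unop),
    hcol.fac _ (SingleObj.star Mᵐᵒᵖ)⟩

/-- The leg of an invariant object is also universal among the morphisms invariant under the
daggers of the action. -/
theorem IsInvariantObject.exists_leg_comp_eq [HasConditionals C]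
    (hinv : HasInvariantObjects.{w} C) {M : Type w} [Monoid M] {D : SingleObj M ⥤ PS C}
    {c : Cocone D} (hc : IsInvariantObject c) {A : PS C} (f : space D ⟶ A)
    (hf : ∀ m : M, PS.dagger (act D m) ≫ f = f) : ∃ k : c.pt ⟶ A, leg c ≫ k = f := by
  obtain ⟨B, r, hr, hr', hu⟩ := exists_dagger_invariant hinv D
  obtain ⟨k, rfl⟩ := hu A f hf
  -- Determinism is needed of `r` only, not of `f`; the action is recovered as `m†† = m`.
  have h : ∀ m : M, act D m ≫ r = r := fun m => by
    simpa only [PS.dagger_dagger] using hr.dagger_comp_eq (hr' m)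
  obtain ⟨hcol, -⟩ := hc
  obtain ⟨u, rfl⟩ : ∃ u : c.pt ⟶ B, leg c ≫ u = r :=
    ⟨hcol.desc (coconeOfRightInvariant r h), hcol.fac _ (SingleObj.star M)⟩
  exact ⟨u ≫ k, (Category.assoc _ _ _).symm⟩

/-- The dagger of the identity `r ∘ m† = r`, which holds because the leg `r` is deterministic and
`m`-invariant. -/
theorem isLeftInvariant_dagger_leg [HasConditionals C] {M : Type w} [Monoid M]
    {D : SingleObj M ⥤ PS C} {c : Cocone D} (hc : IsInvariantObject c) :
    IsLeftInvariant D (PS.dagger (leg c)) := fun m => by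
  have := congrArg PS.dagger (hc.isASDeterministic_leg.dagger_comp_eq (act_comp_leg c m))
  rwa [PS.dagger_comp, PS.dagger_dagger] at this

/-- Left-invariant morphisms factor uniquely through the dagger of an invariant object. -/
theorem IsInvariantObject.existsUnique_comp_dagger_leg [HasConditionals C]
    (hinv : HasInvariantObjects.{w} C) {M : Type w} [Monoid M] {D : SingleObj M ⥤ PS C}
    {c : Cocone D} (hc : IsInvariantObject c) {A : PS C} (g : A ⟶ space D)
    (hg : IsLeftInvariant D g) : ∃! g' : A ⟶ c.pt, g' ≫ PS.dagger (leg c) = g := by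
  obtain ⟨k, hk⟩ := hc.exists_leg_comp_eq hinv (PS.dagger g) fun m => by
    rw [← PS.dagger_comp, hg m]
  refine ⟨PS.dagger k, ?_, fun g' hg' => ?_⟩
  · change PS.dagger k ≫ _ = _
    rw [← PS.dagger_comp, hk, PS.dagger_dagger]
  -- Under the dagger, uniqueness becomes uniqueness of maps out of the colimit.
  · obtain ⟨hcol, -⟩ := hc
    rw [← PS.dagger_dagger g']
    congr 1
    refine hcol.hom_ext fun _ => ?_
    change leg c ≫ _ = leg c ≫ _
    rw [hk, ← hg', PS.dagger_comp, PS.dagger_dagger]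

end Dynamics

end MarkovPS

theorem mainTheorem2 {C : Type u} [Category.{v} C] [MonoidalCategory.{v} C] [MarkovCategory C]
    [MarkovPS.HasConditionals C] (hinv : MarkovPS.HasInvariantObjects.{w} C)
    {M : Type w} [Monoid M] (D : SingleObj M ⥤ MarkovPS.PS C)
    (c : Cocone D) (hc : MarkovPS.IsInvariantObject c) :
    (∃ h : MarkovPS.IsLeftInvariant D (MarkovPS.PS.dagger (MarkovPS.leg c)),
      Nonempty (IsLimit h.cone)) ∧
    ∀ (A : MarkovPS.PS C) (g : A ⟶ MarkovPS.space D), MarkovPS.IsLeftInvariant D g →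
      ∃! g' : A ⟶ c.pt, g' ≫ MarkovPS.PS.dagger (MarkovPS.leg c) = g := by
  have key := fun (A : MarkovPS.PS C) (g : A ⟶ MarkovPS.space D)
    (hg : MarkovPS.IsLeftInvariant D g) => hc.existsUnique_comp_dagger_leg hinv g hg
  have inv : ∀ s : Cone D, MarkovPS.IsLeftInvariant D (s.π.app (SingleObj.star M)) :=
    fun s m => s.w (j := SingleObj.star M) (j' := SingleObj.star M) m
  refine ⟨⟨MarkovPS.isLeftInvariant_dagger_leg hc, ⟨?_⟩⟩, key⟩
  exact
    { lift := fun s => (key s.pt _ (inv s)).choose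
      fac := fun s _ => (key s.pt _ (inv s)).choose_spec.1
      uniq := fun s k hk => (key s.pt _ (inv s)).choose_spec.2 k (hk (SingleObj.star M)) }
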